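/- Consider the penalized network creation game with a finite set $V$ of $n$ players, edge cost $\alpha>0$ and penalty $\beta>1$ (both real). A strategy of player $i$ is a set $s_i\subseteq V\setminus\{i\}$, the set of players to whom $i$ builds an edge; a state $s=(s_i)_{i\in V}$ induces the undirected graph $G_s$ on $V$ in which distinct $i,j$ are adjacent iff $j\in s_i$ or $i\in s_j$. The cost of player $i$ is $c_i(s)=\alpha|s_i|+\sum_{j\ne i}\mathrm{dist}_s(i,j)$, where $\mathrm{dist}_s(i,j)$ is the shortest-path distance in $G_s$ if $i,j$ lie in the same component of $G_s$, and $\mathrm{dist}_s(i,j)=\beta$ otherwise. A state is a (pure) Nash equilibrium if no player can decrease his cost by changing only his own strategy. Let $s$ be a Nash equilibrium such that $G_s$ is disconnected and at least one edge is built in $s$. Let $n_l$ be the minimum number of vertices, and $\mathrm{diam}_l$ the minimum diameter, over all components of $G_s$ with at least two vertices (the two minima may be attained by different components). Then, with $\log$ the natural logarithm, 1. $\alpha<12\,n_l\log n_l$; 2. $\beta\le 1+2\,\mathrm{diam}_l$; 3. $\beta<1+14\sqrt{n_l\log n_l}$; 4. if $n>6$, then $\beta<n/2$. -/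

import Mathlib

namespace PCG

/-- A strategy of player `i`: the set of the other players to whom `i` builds an edge. -/
abbrev Strategy (V : Type*) (i : V) : Type _ := {t : Finset V // i ∉ t}

/-- A state (strategy vector): one strategy for each player. -/
abbrev State (V : Type*) : Type _ := (i : V) → Strategy V i

section Game

variable {V : Type*}

/-- The undirected graph induced by the state `s`: two distinct players are adjacent if at least
one of them builds the edge between them. -/
def graph (s : State V) : SimpleGraph V :=
  SimpleGraph.fromRel fun i j => j ∈ (s i).1

/-- The empty state, in which no player builds an edge. -/
def emptyState (V : Type*) : State V := fun _ => ⟨∅, Finset.notMem_empty _⟩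

open Classical in
/-- The penalized distance: the length of a shortest path for players in the same component,
and the penalty `β` for players in different components. -/
noncomputable def pdist (β : ℝ) (s : State V) (i j : V) : ℝ :=
  if (graph s).Reachable i j then ((graph s).dist i j : ℝ) else β

/-- The individual cost of player `i` in the state `s`. -/
noncomputable def cost [Fintype V] [DecidableEq V] (α β : ℝ) (s : State V) (i : V) : ℝ :=
  α * ((s i).1.card : ℝ) + ∑ j ∈ Finset.univ.erase i, pdist β s i j

/-- The state `s` is a pure Nash equilibrium: no player can decrease his individual cost by
changing only his own strategy. -/
def IsNash [Fintype V] [DecidableEq V] (α β : ℝ) (s : State V) : Prop :=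
  ∀ (i : V) (t : Strategy V i), cost α β s i ≤ cost α β (Function.update s i t) i

/-- The state `s` is disconnected: some two players are not joined by a path. -/
def IsDisconnected (s : State V) : Prop := ¬ (graph s).Preconnected

/-- The sizes of the non-singleton components of the graph of `s`. -/
def componentSizes (s : State V) : Set ℕ :=
  {k | ∃ C : (graph s).ConnectedComponent, C.supp.Nontrivial ∧ k = C.supp.ncard}

/-- The diameters of the non-singleton components of the graph of `s`. -/
noncomputable def componentDiams (s : State V) : Set ℕ :=
  {d | ∃ C : (graph s).ConnectedComponent, C.supp.Nontrivial ∧ d = C.toSimpleGraph.diam}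

/-- The minimum size of a non-singleton component. -/
noncomputable def minSize (s : State V) : ℕ := sInf (componentSizes s)

/-- The minimum diameter of a non-singleton component. -/
noncomputable def minDiam (s : State V) : ℕ := sInf (componentDiams s)

/-- A non-empty state has a non-singleton component. -/
theorem exists_nontrivial_component {s : State V} (hs : s ≠ emptyState V) :
    ∃ C : (graph s).ConnectedComponent, C.supp.Nontrivial := by
  by_contra hC
  push Not at hC
  apply hs
  funext i
  apply Subtype.ext
  apply Finset.eq_empty_of_forall_notMem
  intro j hj
  have hij : i ≠ j := fun h => (s i).2 (by rw [← h] at hj; exact hj)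
  have hadj : (graph s).Adj i j := by
    simp only [graph, SimpleGraph.fromRel_adj]
    exact ⟨hij, Or.inl hj⟩
  refine (Set.not_nontrivial_iff.mpr (hC ((graph s).connectedComponentMk i))) ?_
  refine ⟨i, ?_, j, ?_, hij⟩
  · simp [SimpleGraph.ConnectedComponent.mem_supp_iff]
  · rw [SimpleGraph.ConnectedComponent.mem_supp_iff]
    exact SimpleGraph.ConnectedComponent.sound hadj.symm.reachable

/-- In a non-empty state `minSize` is an attained minimum. -/
theorem isLeast_minSize {s : State V} (hs : s ≠ emptyState V) :
    IsLeast (componentSizes s) (minSize s) := by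
  obtain ⟨C, hC⟩ := exists_nontrivial_component hs
  exact ⟨Nat.sInf_mem ⟨_, C, hC, rfl⟩, fun _ hk => Nat.sInf_le hk⟩

/-- In a non-empty state `minDiam` is an attained minimum. -/
theorem isLeast_minDiam {s : State V} (hs : s ≠ emptyState V) :
    IsLeast (componentDiams s) (minDiam s) := by
  obtain ⟨C, hC⟩ := exists_nontrivial_component hs
  exact ⟨Nat.sInf_mem ⟨_, C, hC, rfl⟩, fun _ hk => Nat.sInf_le hk⟩

end Game

end PCG

/-! Everything follows from four deviations. A player outside a component `C` declines to pay `α`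
for an edge to `x ∈ C`, so `∑_{c ∈ C} (β - 1 - d(x,c)) ≤ α` (`IsNash.outsider_le`). The builder `u`
of a non-bridge edge declines to delete it, so `α` is at most the resulting growth of his distance
sum. Together these eliminate `α`: `β - 1` is at most the average distance from `u` after the
deletion (`IsNash.mul_card_le_of_delete`). That average is at most twice the diameter, and at most
`(|C| - 1)/2 ≤ (n - 2)/2`, whence `β ≤ 1 + 2 diam` and `β ≤ n/2`. Equality in the latter forces a
path, which is excluded by a swap of edges or by a bridge at a leaf. At a bridge the same two
deviations are split over its two sides (`IsNash.bridge`).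

If `α > 4k|C|`, then `C` has neither leaves nor short cycles, and the swap (`IsNash.false_of_swap`)
gives the receiving end of every edge two further neighbours. Breadth-first levels then at least
double every two steps, so `2 ^ k ≤ |C|` (`IsNash.lt_two_pow`), which fails for `k` just above `log₂
|C|`. Finally, buying an edge between the ends of a geodesic yields `diam² ≤ 4α + 1`
(`IsNash.dist_sq_le`), which turns the diameter bound on `β` into the bound by `√(n log n)`. -/

namespace PCG

/-! ### Distances, edge deletion and distance sums -/

section Graphs

variable {V : Type*}

theorem exists_adj_dist_eq {G : SimpleGraph V} {r x : V} {k : ℕ} (h : G.Reachable r x)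
    (hk : G.dist r x = k + 1) : ∃ y, G.Adj y x ∧ G.Reachable r y ∧ G.dist r y = k := by
  obtain ⟨p, hp⟩ := h.symm.exists_walk_length_eq_dist
  rw [SimpleGraph.dist_comm, hk] at hp
  cases p with
  | nil => simp at hp
  | @cons _ y _ hadj q =>
    refine ⟨y, hadj.symm, q.reachable.symm, ?_⟩
    simp only [SimpleGraph.Walk.length_cons, Nat.add_right_cancel_iff] at hp
    have h1 : G.dist r y ≤ k := by
      rw [SimpleGraph.dist_comm, ← hp]; exact SimpleGraph.dist_le q
    obtain ⟨w, hw⟩ := q.reachable.symm.exists_walk_length_eq_dist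
    have h2 : G.dist r x ≤ (w.concat hadj.symm).length := SimpleGraph.dist_le _
    rw [SimpleGraph.Walk.length_concat] at h2
    omega

theorem dist_le_add {G : SimpleGraph V} {x y z : V} (h : G.Reachable x y) (h' : G.Reachable y z) :
    G.dist x z ≤ G.dist x y + G.dist y z := by
  obtain ⟨p, hp⟩ := h.exists_walk_length_eq_dist
  obtain ⟨q, hq⟩ := h'.exists_walk_length_eq_dist
  rw [← hp, ← hq, ← SimpleGraph.Walk.length_append]
  exact SimpleGraph.dist_le _

theorem dist_adj_le {G : SimpleGraph V} {r x y : V} (h : G.Reachable r x) (hxy : G.Adj x y) :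
    G.dist r y ≤ G.dist r x + 1 := by
  have := dist_le_add h hxy.reachable
  rwa [SimpleGraph.dist_eq_one_iff_adj.2 hxy] at this

/-- Every level up to the distance of `x` from `r` is met by a geodesic. -/
theorem exists_dist_eq {G : SimpleGraph V} {r x : V} (h : G.Reachable r x) (i : ℕ)
    (hi : i ≤ G.dist r x) :
    ∃ y, G.Reachable r y ∧ G.dist r y = i ∧ G.dist y x = G.dist r x - i := by
  obtain ⟨d, hd⟩ : ∃ d, G.dist r x = i + d := ⟨_, (Nat.add_sub_cancel' hi).symm⟩
  clear hi
  induction d generalizing x with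
  | zero => exact ⟨x, h, hd, by simp [hd]⟩
  | succ d ih =>
    obtain ⟨y, hyx, hry, hy⟩ := exists_adj_dist_eq (k := i + d) h hd
    obtain ⟨z, hz, hzi, hzy⟩ := ih hry hy
    refine ⟨z, hz, hzi, ?_⟩
    have h1 := dist_adj_le (hz.symm.trans hry) hyx
    have h2 := dist_le_add hz (hz.symm.trans h)
    omega

/-- Deleting the edge `ab`: a vertex keeps its distance from `r`, or all its geodesics
from `r` traverse the edge from `a` to `b`. -/
theorem dist_of_delete {G H : SimpleGraph V} {a b r : V}
    (hGH : ∀ x y, G.Adj x y → ¬(x = a ∧ y = b) → ¬(x = b ∧ y = a) → H.Adj x y)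
    (hab : G.dist r a ≤ G.dist r b) {x : V} (hx : G.Reachable r x) :
    (H.Reachable r x ∧ H.dist r x ≤ G.dist r x) ∨
      (H.Reachable b x ∧ G.dist r a + 1 + H.dist b x ≤ G.dist r x) := by
  obtain ⟨k, hk⟩ : ∃ k, G.dist r x = k := ⟨_, rfl⟩
  induction k generalizing x with
  | zero =>
    rw [hx.dist_eq_zero_iff] at hk
    subst hk
    left
    simp
  | succ k ih =>
    obtain ⟨y, hyx, hry, hy⟩ := exists_adj_dist_eq hx hk
    by_cases h1 : y = a ∧ x = b
    · right
      obtain ⟨rfl, rfl⟩ := h1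
      simp [hy, hk]
    -- A geodesic from `r` never traverses the edge from `b` to `a`, as `a` is no farther than `b`.
    · by_cases h2 : y = b ∧ x = a
      · obtain ⟨rfl, rfl⟩ := h2
        omega
      · have hH := hGH y x hyx h1 h2
        rcases ih hry hy with ⟨hr, hd⟩ | ⟨hr, hd⟩
        · left
          have := dist_adj_le hr hH
          exact ⟨hr.trans hH.reachable, by omega⟩
        · right
          have := dist_adj_le hr hH
          exact ⟨hr.trans hH.reachable, by omega⟩

theorem exists_boundary_adj {H : SimpleGraph V} {P : V → Prop} {x y : V} (h : H.Reachable x y)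
    (hx : P x) (hy : ¬ P y) : ∃ a b, H.Adj a b ∧ P a ∧ ¬ P b ∧ H.Reachable b y := by
  obtain ⟨p⟩ := h
  induction p with
  | nil => exact absurd hx hy
  | @cons u v w hadj q ih =>
    by_cases hv : P v
    · exact ih hv hy
    · exact ⟨u, v, hadj, hx, hv, q.reachable⟩

/-- Deleting an edge `uv` without disconnecting at most doubles the distances from `u`. -/
theorem dist_delete_le_two_mul {G H : SimpleGraph V} {u v c : V} {d : ℕ}
    (hGH : ∀ x y, G.Adj x y → ¬(x = u ∧ y = v) → ¬(x = v ∧ y = u) → H.Adj x y) (hle : H ≤ G)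
    (hc : H.Reachable c u) (hd : ∀ x, G.Reachable c x → G.dist c x ≤ d) :
    H.dist c u ≤ 2 * d := by
  have hcu : G.Reachable c u := hc.mono hle
  have hdu := hd u hcu
  rcases le_total (G.dist c u) (G.dist c v) with h | h
  · rcases dist_of_delete hGH h hcu with ⟨_, h2⟩ | ⟨_, h2⟩ <;> omega
  · have hGH' : ∀ x y, G.Adj x y → ¬(x = v ∧ y = u) → ¬(x = u ∧ y = v) → H.Adj x y :=
      fun x y h1 h2 h3 => hGH x y h1 h3 h2
    by_cases hP : H.dist c u ≤ G.dist c u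
    · omega
    -- On a path of `H` from `c` to `u`, let `b` be a vertex that loses its distance right after a
    -- vertex `a` that keeps it. Then `H.dist c b ≤ d + 1`, and the geodesics of `G` to `b` pass
    -- through `u`, so `H.dist u b ≤ d - 1`.
    · obtain ⟨a, b, hab, ha, hb, hbu⟩ := exists_boundary_adj
        (P := fun x => H.Reachable c x ∧ H.dist c x ≤ G.dist c x) hc (by simp) (fun h => hP h.2)
      have hcb : G.Reachable c b := (ha.1.trans hab.reachable).mono hle
      have hda := hd a (ha.1.mono hle)
      have hdb := hd b hcb
      rcases dist_of_delete hGH' h hcb with h1 | ⟨_, h2⟩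
      · exact absurd h1 hb
      · have h3 := dist_adj_le ha.1 hab
        have h4 := dist_le_add (ha.1.trans hab.reachable) hbu
        rw [SimpleGraph.dist_comm (u := b)] at h4
        have h5 := ha.2
        omega

theorem dist_le_of_le {G H : SimpleGraph V} (hle : H ≤ G) {x y : V} (h : H.Reachable x y) :
    G.dist x y ≤ H.dist x y := by
  obtain ⟨p, hp⟩ := h.exists_walk_length_eq_dist
  rw [← hp, ← SimpleGraph.Walk.length_map (SimpleGraph.Hom.ofLE hle)]
  exact SimpleGraph.dist_le _

theorem reachable_of_forall_adj {G H : SimpleGraph V} (h : ∀ x y, H.Adj x y → G.Reachable x y)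
    {x y : V} (hxy : H.Reachable x y) : G.Reachable x y := by
  obtain ⟨p⟩ := hxy
  induction p with
  | nil => rfl
  | cons hadj _ ih => exact (h _ _ hadj).trans ih

/-- Without a maximal element the values still form an initial segment, and the maximum is at most
the number of remaining elements; so the sum is at most `0 + 1 + ... + (|S| - 1)`. For distances
from a vertex, equality means one vertex per level, that is, a path. -/
theorem sum_downward_closed (S : Finset V) (f : V → ℕ)
    (h : ∀ x ∈ S, ∀ i ≤ f x, ∃ y ∈ S, f y = i) :
    2 * ∑ x ∈ S, f x ≤ S.card * (S.card - 1) ∧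
      (2 * ∑ x ∈ S, f x = S.card * (S.card - 1) →
        Set.InjOn f S ∧ ∀ i < S.card, ∃ y ∈ S, f y = i) := by
  classical
  induction S using Finset.induction_on_max_value f with
  | empty => simp
  | insert a S ha hmax ih =>
    have hfa : f a ≤ S.card := by
      have : Finset.range (f a + 1) ⊆ (insert a S).image f := by
        intro i hi
        obtain ⟨y, hy, hyi⟩ := h a (Finset.mem_insert_self _ _) i
          (Nat.lt_succ_iff.1 (Finset.mem_range.1 hi))
        exact Finset.mem_image.2 ⟨y, hy, hyi⟩
      have := (Finset.card_le_card this).trans Finset.card_image_le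
      rw [Finset.card_range, Finset.card_insert_of_notMem ha] at this
      omega
    have hS := (ih (by
      intro x hx i hi
      rcases hi.eq_or_lt with rfl | hlt
      · exact ⟨x, hx, rfl⟩
      · obtain ⟨y, hy, hyi⟩ := h x (Finset.mem_insert_of_mem hx) i hi
        rcases Finset.mem_insert.1 hy with rfl | hy
        · have := hmax x hx
          omega
        · exact ⟨y, hy, hyi⟩)).1
    rw [Finset.sum_insert ha, Finset.card_insert_of_notMem ha]
    have key : S.card * (S.card - 1) + 2 * S.card = (S.card + 1) * (S.card + 1 - 1) := by
      cases S.card with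
      | zero => rfl
      | succ n => simp only [Nat.add_sub_cancel]; ring
    refine ⟨by omega, fun heq => ?_⟩
    have hfa' : f a = S.card := by omega
    have hall : ∀ i < S.card + 1, ∃ y ∈ insert a S, f y = i := fun i hi =>
      h a (Finset.mem_insert_self _ _) i (by omega)
    refine ⟨?_, hall⟩
    have himg : (insert a S).image f = Finset.range (S.card + 1) := by
      apply (Finset.eq_of_subset_of_card_le _ _).symm
      · intro i hi
        obtain ⟨y, hy, hyi⟩ := hall i (Finset.mem_range.1 hi)
        exact Finset.mem_image.2 ⟨y, hy, hyi⟩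
      · rw [Finset.card_range, ← Finset.card_insert_of_notMem ha]
        exact Finset.card_image_le
    apply Finset.injOn_of_card_image_eq
    rw [himg, Finset.card_range, Finset.card_insert_of_notMem ha]

open Classical in
/-- The vertices reachable from `u`. -/
noncomputable def comp [Fintype V] (G : SimpleGraph V) (u : V) : Finset V :=
  Finset.univ.filter (G.Reachable u)

section Comp

variable [Fintype V]

@[simp]
theorem mem_comp {G : SimpleGraph V} {u x : V} : x ∈ comp G u ↔ G.Reachable u x := by
  simp [comp]

theorem comp_congr {G : SimpleGraph V} {u v : V} (h : G.Reachable u v) : comp G u = comp G v := by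
  ext x
  simp only [mem_comp]
  exact ⟨fun h' => h.symm.trans h', fun h' => h.trans h'⟩

theorem comp_dist_downward_closed (G : SimpleGraph V) (u : V) :
    ∀ x ∈ comp G u, ∀ i ≤ G.dist u x, ∃ y ∈ comp G u, G.dist u y = i := by
  intro x hx i hi
  obtain ⟨y, hy, hyi, _⟩ := exists_dist_eq (mem_comp.1 hx) i hi
  exact ⟨y, mem_comp.2 hy, hyi⟩

theorem one_le_card_comp (G : SimpleGraph V) (u : V) : 1 ≤ (comp G u).card :=
  Finset.card_pos.2 ⟨u, by simp⟩

theorem two_mul_sum_dist_le (G : SimpleGraph V) (u : V) :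
    2 * ∑ x ∈ comp G u, (G.dist u x : ℝ) ≤ (comp G u).card * ((comp G u).card - 1) := by
  have h := (sum_downward_closed _ _ (comp_dist_downward_closed G u)).1
  have h' : ((2 * ∑ x ∈ comp G u, G.dist u x : ℕ) : ℝ) ≤
      (((comp G u).card * ((comp G u).card - 1) : ℕ) : ℝ) := by exact_mod_cast h
  push_cast [one_le_card_comp G u] at h'
  exact h'

end Comp

end Graphs

/-! ### Deviations of a single player -/

section Moves

variable {V : Type*}

theorem graph_adj {s : State V} {i j : V} :
    (graph s).Adj i j ↔ i ≠ j ∧ (j ∈ (s i).1 ∨ i ∈ (s j).1) := by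
  simp [graph, SimpleGraph.fromRel_adj]

theorem ne_of_mem_strategy {s : State V} {u v : V} (h : v ∈ (s u).1) : u ≠ v := by
  rintro rfl
  exact (s u).2 h

theorem adj_of_mem_strategy {s : State V} {u v : V} (h : v ∈ (s u).1) : (graph s).Adj u v :=
  graph_adj.2 ⟨ne_of_mem_strategy h, Or.inl h⟩

theorem IsDisconnected.exists_not_reachable {s : State V} (h : IsDisconnected s) (x : V) :
    ∃ w, ¬ (graph s).Reachable w x := by
  by_contra! hc
  exact h fun a b => (hc a).trans (hc b).symm

variable [DecidableEq V]

theorem graph_update_adj_left {s : State V} {u y : V} {t : Strategy V u} :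
    (graph (Function.update s u t)).Adj u y ↔ u ≠ y ∧ (y ∈ t.1 ∨ u ∈ (s y).1) := by
  rw [graph_adj, Function.update_self]
  refine and_congr_right fun h => ?_
  rw [Function.update_of_ne h.symm]

theorem graph_update_adj_of_ne {s : State V} {u x y : V} {t : Strategy V u} (hx : x ≠ u)
    (hy : y ≠ u) : (graph (Function.update s u t)).Adj x y ↔ (graph s).Adj x y := by
  rw [graph_adj, graph_adj, Function.update_of_ne hx, Function.update_of_ne hy]

/-- The edges of a state in which `u` has changed his strategy to `t`. -/
theorem graph_update_adj_cases {s : State V} {u x y : V} {t : Strategy V u}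
    (h : (graph (Function.update s u t)).Adj x y) :
    (graph s).Adj x y ∨ (x = u ∧ y ∈ t.1) ∨ (y = u ∧ x ∈ t.1) := by
  by_cases hx : x = u
  · subst hx
    rw [graph_update_adj_left] at h
    rcases h with ⟨h1, h2 | h2⟩
    · exact Or.inr (Or.inl ⟨rfl, h2⟩)
    · exact Or.inl (graph_adj.2 ⟨h1, Or.inr h2⟩)
  · by_cases hy : y = u
    · subst hy
      replace h := h.symm
      rw [graph_update_adj_left] at h
      rcases h with ⟨h1, h2 | h2⟩
      · exact Or.inr (Or.inr ⟨rfl, h2⟩)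
      · exact Or.inl (graph_adj.2 ⟨h1.symm, Or.inl h2⟩)
    · exact Or.inl ((graph_update_adj_of_ne hx hy).1 h)

/-- An edge survives a change of the strategy of `u` unless `u` has ceased to build it. -/
theorem graph_update_adj_of_adj {s : State V} {u x y : V} {t : Strategy V u}
    (h : (graph s).Adj x y) (hx : x = u → y ∈ (s u).1 → y ∈ t.1)
    (hy : y = u → x ∈ (s u).1 → x ∈ t.1) : (graph (Function.update s u t)).Adj x y := by
  by_cases hxu : x = u
  · subst hxu
    rw [graph_update_adj_left]
    obtain ⟨h1, h2⟩ := graph_adj.1 h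
    exact ⟨h1, h2.imp_left (hx rfl)⟩
  · by_cases hyu : y = u
    · subst hyu
      apply SimpleGraph.Adj.symm
      rw [graph_update_adj_left]
      obtain ⟨h1, h2⟩ := graph_adj.1 h
      exact ⟨h1.symm, h2.symm.imp_left (hy rfl)⟩
    · exact (graph_update_adj_of_ne hxu hyu).2 h

/-- Player `u` ceases to build the edge to `v`. -/
def deleteMove (s : State V) (u v : V) : Strategy V u :=
  ⟨(s u).1.erase v, fun h => (s u).2 (Finset.mem_of_mem_erase h)⟩

/-- Player `u` builds an additional edge to `v`. -/
def insertMove (s : State V) (u v : V) (h : u ≠ v) : Strategy V u :=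
  ⟨insert v (s u).1, fun h' => (Finset.mem_insert.1 h').elim h (s u).2⟩

/-- Player `u` builds an edge to `x` instead of `w`. -/
def swapMove (s : State V) (u w x : V) (h : u ≠ x) : Strategy V u :=
  ⟨insert x ((s u).1.erase w), fun h' =>
    (Finset.mem_insert.1 h').elim h fun h => (s u).2 (Finset.mem_of_mem_erase h)⟩

/-- The graph after `u` has ceased to build the edge to `v`. -/
abbrev deleteGraph (s : State V) (u v : V) : SimpleGraph V :=
  graph (Function.update s u (deleteMove s u v))

theorem deleteGraph_le (s : State V) (u v : V) : deleteGraph s u v ≤ graph s := by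
  intro x y h
  rcases graph_update_adj_cases h with h | ⟨rfl, h⟩ | ⟨rfl, h⟩
  · exact h
  · exact adj_of_mem_strategy (Finset.mem_of_mem_erase h)
  · exact (adj_of_mem_strategy (Finset.mem_of_mem_erase h)).symm

theorem deleteGraph_adj {s : State V} {u v x y : V} (h : (graph s).Adj x y)
    (h1 : ¬(x = u ∧ y = v)) (h2 : ¬(x = v ∧ y = u)) : (deleteGraph s u v).Adj x y := by
  apply graph_update_adj_of_adj h
  · rintro rfl hy
    exact Finset.mem_erase.2 ⟨fun h => h1 ⟨rfl, h⟩, hy⟩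
  · rintro rfl hx
    exact Finset.mem_erase.2 ⟨fun h => h2 ⟨h, rfl⟩, hx⟩

theorem card_deleteMove {s : State V} {u v : V} (h : v ∈ (s u).1) :
    ((deleteMove s u v).1.card : ℝ) = (s u).1.card - 1 := by
  have := Finset.card_erase_add_one h
  rw [deleteMove, ← this]
  push_cast
  ring

variable [Fintype V] {α β : ℝ} {s : State V}

/-- Measuring every distance relative to `β` confines the sum to the component of `u`; the remaining
term does not depend on the state, so it cancels when moves are compared. -/
theorem cost_eq (s : State V) (u : V) : cost α β s u =
    α * (s u).1.card + ∑ c ∈ comp (graph s) u, (((graph s).dist u c : ℝ) - β) +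
      β * Fintype.card V := by
  have h1 : ∑ j ∈ Finset.univ.erase u, pdist β s u j = ∑ j, (pdist β s u j - β) +
      β * Fintype.card V := by
    rw [Finset.sum_sub_distrib, ← Finset.add_sum_erase _ _ (Finset.mem_univ u)]
    simp [pdist]
    ring
  have h2 : ∑ j, (pdist β s u j - β) = ∑ c ∈ comp (graph s) u, (((graph s).dist u c : ℝ) - β) := by
    rw [comp, Finset.sum_filter]
    refine Finset.sum_congr rfl fun j _ => ?_
    by_cases hj : (graph s).Reachable u j <;> simp [pdist, hj]
  rw [cost, h1, h2, add_assoc]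

theorem IsNash.le_of_move (h : IsNash α β s) (u : V) (t : Strategy V u) :
    α * (s u).1.card + ∑ c ∈ comp (graph s) u, (((graph s).dist u c : ℝ) - β) ≤
      α * t.1.card + ∑ c ∈ comp (graph (Function.update s u t)) u,
        (((graph (Function.update s u t)).dist u c : ℝ) - β) := by
  have := h u t
  rw [cost_eq, cost_eq, Function.update_self] at this
  linarith

theorem IsNash.le_of_move_of_comp_eq (h : IsNash α β s) (u : V) (t : Strategy V u)
    (hc : comp (graph (Function.update s u t)) u = comp (graph s) u) :
    α * (s u).1.card + ∑ c ∈ comp (graph s) u, ((graph s).dist u c : ℝ) ≤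
      α * t.1.card + ∑ c ∈ comp (graph s) u,
        ((graph (Function.update s u t)).dist u c : ℝ) := by
  have := h.le_of_move u t
  rw [hc, Finset.sum_sub_distrib, Finset.sum_sub_distrib] at this
  linarith

/-- A player outside of the component of `x` does not gain by building an edge to `x`. -/
theorem IsNash.outsider_le (h : IsNash α β s) (hα : 0 < α) {w x : V}
    (hw : ¬ (graph s).Reachable w x) :
    ∑ c ∈ comp (graph s) x, (β - 1 - ((graph s).dist x c : ℝ)) ≤ α := by
  have hwx : w ≠ x := by rintro rfl; exact hw (by rfl)
  have hle := h.le_of_move w (insertMove s w x hwx)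
  set H := graph (Function.update s w (insertMove s w x hwx)) with hH
  have hGH : graph s ≤ H := fun a b hab =>
    graph_update_adj_of_adj hab (fun _ => Finset.mem_insert_of_mem)
      (fun _ => Finset.mem_insert_of_mem)
  have hadj : H.Adj w x := graph_update_adj_left.2 ⟨hwx, Or.inl (Finset.mem_insert_self _ _)⟩
  have hcases : ∀ a b, H.Adj a b → (graph s).Adj a b ∨ (a = w ∧ b = x) ∨ (b = w ∧ a = x) := by
    intro a b hab
    rcases graph_update_adj_cases hab with h1 | ⟨rfl, h1⟩ | ⟨rfl, h1⟩
    · exact Or.inl h1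
    · rcases Finset.mem_insert.1 h1 with rfl | h1
      · exact Or.inr (Or.inl ⟨rfl, rfl⟩)
      · exact Or.inl (adj_of_mem_strategy h1)
    · rcases Finset.mem_insert.1 h1 with rfl | h1
      · exact Or.inr (Or.inr ⟨rfl, rfl⟩)
      · exact Or.inl (adj_of_mem_strategy h1).symm
  have hreach : ∀ c, H.Reachable w c → (graph s).Reachable w c ∨ (graph s).Reachable x c := by
    intro c hc
    by_contra hnot
    obtain ⟨a, b, hab, ha, hb, _⟩ := exists_boundary_adj
      (P := fun c => (graph s).Reachable w c ∨ (graph s).Reachable x c) hc (Or.inl (by rfl)) hnot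
    rcases hcases a b hab with h1 | ⟨rfl, rfl⟩ | ⟨rfl, rfl⟩
    · exact hb (ha.imp (fun h => h.trans h1.reachable) fun h => h.trans h1.reachable)
    · exact hb (Or.inr (by rfl))
    · exact hb (Or.inl (by rfl))
  have hdisj : Disjoint (comp (graph s) w) (comp (graph s) x) := by
    rw [Finset.disjoint_left]
    intro c h1 h2
    exact hw ((mem_comp.1 h1).trans (mem_comp.1 h2).symm)
  have hcomp : comp H w = (comp (graph s) w).disjUnion (comp (graph s) x) hdisj := by
    ext c
    simp only [mem_comp, Finset.mem_disjUnion]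
    refine ⟨hreach c, fun h1 => h1.elim (fun h1 => h1.mono hGH) fun h1 => ?_⟩
    exact hadj.reachable.trans (h1.mono hGH)
  rw [hcomp, Finset.sum_disjUnion] at hle
  have hsum1 : ∑ c ∈ comp (graph s) w, ((H.dist w c : ℝ) - β) ≤
      ∑ c ∈ comp (graph s) w, (((graph s).dist w c : ℝ) - β) := by
    refine Finset.sum_le_sum fun c hc => ?_
    have := dist_le_of_le hGH (mem_comp.1 hc)
    have : (H.dist w c : ℝ) ≤ (graph s).dist w c := by exact_mod_cast this
    linarith
  have hsum2 : ∑ c ∈ comp (graph s) x, ((H.dist w c : ℝ) - β) ≤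
      - ∑ c ∈ comp (graph s) x, (β - 1 - ((graph s).dist x c : ℝ)) := by
    rw [← Finset.sum_neg_distrib]
    refine Finset.sum_le_sum fun c hc => ?_
    have h1 := dist_le_of_le hGH (mem_comp.1 hc)
    have h2 := dist_le_add hadj.reachable ((mem_comp.1 hc).mono hGH)
    rw [SimpleGraph.dist_eq_one_iff_adj.2 hadj] at h2
    have : (H.dist w c : ℝ) ≤ 1 + (graph s).dist x c := by exact_mod_cast h2.trans (by omega)
    linarith
  have hcard : ((insertMove s w x hwx).1.card : ℝ) ≤ (s w).1.card + 1 := by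
    exact_mod_cast Finset.card_insert_le _ _
  nlinarith

/-- Buying an edge inside of the component: the sum of the gains is at most `α`. -/
theorem IsNash.insider_le (h : IsNash α β s) (hα : 0 < α) {x y : V}
    (hxy : (graph s).Reachable x y) (hne : x ≠ y) :
    ∑ c ∈ comp (graph s) x, (((graph s).dist x c - (1 + (graph s).dist y c) : ℕ) : ℝ) ≤ α := by
  have hle := h.le_of_move_of_comp_eq x (insertMove s x y hne)
  set H := graph (Function.update s x (insertMove s x y hne)) with hH
  have hGH : graph s ≤ H := fun a b hab =>
    graph_update_adj_of_adj hab (fun _ => Finset.mem_insert_of_mem)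
      (fun _ => Finset.mem_insert_of_mem)
  have hadj : H.Adj x y := graph_update_adj_left.2 ⟨hne, Or.inl (Finset.mem_insert_self _ _)⟩
  have hreach : ∀ a b, H.Adj a b → (graph s).Reachable a b := by
    intro a b hab
    rcases graph_update_adj_cases hab with h1 | ⟨rfl, h1⟩ | ⟨rfl, h1⟩
    · exact h1.reachable
    · rcases Finset.mem_insert.1 h1 with rfl | h1
      · exact hxy
      · exact (adj_of_mem_strategy h1).reachable
    · rcases Finset.mem_insert.1 h1 with rfl | h1
      · exact hxy.symm
      · exact (adj_of_mem_strategy h1).symm.reachable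
  specialize hle (by
    ext c
    simp only [mem_comp]
    exact ⟨reachable_of_forall_adj hreach, fun h => h.mono hGH⟩)
  -- The truncated subtraction gives `0` where the new edge is no shortcut; there it suffices that
  -- distances do not grow.
  have hsum : ∑ c ∈ comp (graph s) x, (((graph s).dist x c - (1 + (graph s).dist y c) : ℕ) : ℝ) ≤
      ∑ c ∈ comp (graph s) x, (((graph s).dist x c : ℝ) - H.dist x c) := by
    refine Finset.sum_le_sum fun c hc => ?_
    have h1 := dist_le_of_le hGH (mem_comp.1 hc)
    have h2 := dist_le_add hadj.reachable ((hxy.symm.trans (mem_comp.1 hc)).mono hGH)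
    have h3 := dist_le_of_le hGH (hxy.symm.trans (mem_comp.1 hc))
    rw [SimpleGraph.dist_eq_one_iff_adj.2 hadj] at h2
    rw [le_sub_iff_add_le]
    exact_mod_cast (by omega :
      (graph s).dist x c - (1 + (graph s).dist y c) + H.dist x c ≤ (graph s).dist x c)
  rw [Finset.sum_sub_distrib] at hsum
  have hcard : ((insertMove s x y hne).1.card : ℝ) ≤ (s x).1.card + 1 := by
    exact_mod_cast Finset.card_insert_le _ _
  nlinarith

/-- Deleting an edge that is not a bridge. -/
theorem IsNash.le_of_delete (h : IsNash α β s) {u v : V} (hv : v ∈ (s u).1)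
    (hr : (deleteGraph s u v).Reachable u v) :
    comp (deleteGraph s u v) u = comp (graph s) u ∧
    α + ∑ c ∈ comp (graph s) u, ((graph s).dist u c : ℝ) ≤
      ∑ c ∈ comp (graph s) u, ((deleteGraph s u v).dist u c : ℝ) := by
  have hcomp : comp (deleteGraph s u v) u = comp (graph s) u := by
    ext c
    simp only [mem_comp]
    refine ⟨fun h => h.mono (deleteGraph_le s u v), fun hc => ?_⟩
    rcases dist_of_delete (a := u) (b := v) (fun x y => deleteGraph_adj) (by simp) hc with h1 | h1
    · exact h1.1
    · exact hr.trans h1.1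
  refine ⟨hcomp, ?_⟩
  have hle := h.le_of_move_of_comp_eq u (deleteMove s u v) hcomp
  rw [card_deleteMove hv] at hle
  linarith

/-- Deleting a bridge from `u` to `v`: let `S` be the part that stays with `u`. -/
theorem IsNash.bridge (h : IsNash α β s) (hα : 0 < α) {u v w : V} (hv : v ∈ (s u).1)
    (hr : ¬ (deleteGraph s u v).Reachable u v) (hw : ¬ (graph s).Reachable w u) :
    ∃ S T : Finset V, u ∈ S ∧ v ∈ T ∧ S = comp (deleteGraph s u v) u ∧
      (∀ c ∈ T, (deleteGraph s u v).Reachable v c) ∧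
      S.card + T.card = (comp (graph s) u).card ∧
      α ≤ ∑ c ∈ T, (β - ((graph s).dist u c : ℝ)) ∧
      ∑ c ∈ S, (β - 1 - ((graph s).dist v c : ℝ)) ≤ 0 ∧
      ∑ c ∈ S, (β - 1 - ((graph s).dist u c : ℝ)) ≤ T.card := by
  set G := graph s with hG
  set H := deleteGraph s u v with hH
  have hle : H ≤ G := deleteGraph_le s u v
  have hdich : ∀ c, G.Reachable u c → (H.Reachable u c ∧ H.dist u c ≤ G.dist u c) ∨
      (H.Reachable v c ∧ 1 + H.dist v c ≤ G.dist u c) := by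
    intro c hc
    have := dist_of_delete (H := H) (a := u) (b := v) (fun x y => deleteGraph_adj) (by simp) hc
    simpa using this
  have huv : G.Reachable u v := (adj_of_mem_strategy hv).reachable
  have hSC : comp H u ⊆ comp G u := fun c hc => mem_comp.2 ((mem_comp.1 hc).mono hle)
  have hT : ∀ c ∈ comp G u \ comp H u, H.Reachable v c ∧ 1 + H.dist v c ≤ G.dist u c := by
    intro c hc
    rw [Finset.mem_sdiff, mem_comp, mem_comp] at hc
    exact (hdich c hc.1).resolve_left fun h => hc.2 h.1
  have hsplit : ∀ f : V → ℝ, ∑ c ∈ comp G u, f c =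
      ∑ c ∈ comp G u \ comp H u, f c + ∑ c ∈ comp H u, f c := fun f =>
    (Finset.sum_sdiff hSC).symm
  have h1 : α ≤ ∑ c ∈ comp G u \ comp H u, (β - (G.dist u c : ℝ)) := by
    have hmove := h.le_of_move u (deleteMove s u v)
    rw [card_deleteMove hv, hsplit] at hmove
    have hS : ∑ c ∈ comp H u, ((H.dist u c : ℝ) - β) ≤ ∑ c ∈ comp H u, ((G.dist u c : ℝ) - β) := by
      refine Finset.sum_le_sum fun c hc => ?_
      rw [mem_comp] at hc
      rcases hdich c (hc.mono hle) with h1 | h1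
      · have : (H.dist u c : ℝ) ≤ G.dist u c := by exact_mod_cast h1.2
        linarith
      · exact absurd (hc.trans h1.1.symm) hr
    have hneg : ∑ c ∈ comp G u \ comp H u, (β - (G.dist u c : ℝ)) =
        - ∑ c ∈ comp G u \ comp H u, ((G.dist u c : ℝ) - β) := by
      rw [← Finset.sum_neg_distrib]
      exact Finset.sum_congr rfl fun c _ => by ring
    rw [hneg]
    linarith
  -- An outsider declines an edge to `u` and an edge to `v`. With both sums split over the two sides
  -- of the bridge, `h1` absorbs the part beyond it: fully for `v`, since `d(u,c) ≥ 1 + d(v,c)`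
  -- there, and up to one unit per vertex for `u`.
  have h2 := h.outsider_le hα hw
  have h3 := h.outsider_le hα (x := v) fun h => hw (h.trans huv.symm)
  rw [← comp_congr huv, hsplit] at h3
  rw [hsplit] at h2
  refine ⟨comp H u, comp G u \ comp H u, by simp, ?_, rfl, fun c hc => (hT c hc).1, ?_, h1, ?_, ?_⟩
  · rw [Finset.mem_sdiff, mem_comp, mem_comp]
    exact ⟨huv, hr⟩
  · rw [add_comm]
    exact Finset.card_sdiff_add_card_eq_card hSC
  · have : ∑ c ∈ comp G u \ comp H u, (β - (G.dist u c : ℝ)) ≤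
        ∑ c ∈ comp G u \ comp H u, (β - 1 - (G.dist v c : ℝ)) := by
      refine Finset.sum_le_sum fun c hc => ?_
      have h4 := hT c hc
      have h5 := dist_le_of_le hle h4.1
      have : 1 + (G.dist v c : ℝ) ≤ G.dist u c := by exact_mod_cast (by omega)
      linarith
    linarith
  · have : ∑ c ∈ comp G u \ comp H u, (β - (G.dist u c : ℝ)) =
        ∑ c ∈ comp G u \ comp H u, (β - 1 - (G.dist u c : ℝ)) + (comp G u \ comp H u).card := by
      rw [← nsmul_one, ← Finset.sum_const, ← Finset.sum_add_distrib]
      exact Finset.sum_congr rfl fun c _ => by ring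
    linarith

/-- Numerical consequences of the existence of a bridge. -/
theorem IsNash.bridge_card (h : IsNash α β s) (hα : 0 < α) {u v w : V} (hv : v ∈ (s u).1)
    (hr : ¬ (deleteGraph s u v).Reachable u v) (hw : ¬ (graph s).Reachable w u) :
    ∃ S T : Finset V, u ∈ S ∧ v ∈ T ∧ (∀ c ∈ S, (deleteGraph s u v).Reachable u c) ∧
      (∀ c ∈ T, (deleteGraph s u v).Reachable v c) ∧
      S.card + T.card = (comp (graph s) u).card ∧
      α ≤ T.card * (β - 1) ∧ 2 * (β - 1) ≤ S.card + 1 ∧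
      2 * S.card * β ≤ S.card * (S.card + 1 : ℝ) + 2 * T.card := by
  obtain ⟨S, T, hu, hvT, hS, hT, hcard, h1, h2, h3⟩ := h.bridge hα hv hr hw
  have hle := deleteGraph_le s u v
  have hpos : (0 : ℝ) < S.card := by exact_mod_cast Finset.card_pos.2 ⟨u, hu⟩
  -- `S` is a whole component once the bridge is deleted, so the bound on distance sums applies
  -- there; distances in `graph s` are no larger.
  have hsum : 2 * ∑ c ∈ S, ((graph s).dist u c : ℝ) ≤ S.card * (S.card - 1) := by
    have h4 := two_mul_sum_dist_le (deleteGraph s u v) u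
    rw [← hS] at h4
    refine le_trans ?_ h4
    refine mul_le_mul_of_nonneg_left (Finset.sum_le_sum fun c hc => ?_) zero_le_two
    rw [hS, mem_comp] at hc
    exact_mod_cast dist_le_of_le hle hc
  have hsum' : ∑ c ∈ S, ((graph s).dist v c : ℝ) ≤ ∑ c ∈ S, ((graph s).dist u c : ℝ) + S.card := by
    rw [← nsmul_one, ← Finset.sum_const, ← Finset.sum_add_distrib]
    refine Finset.sum_le_sum fun c hc => ?_
    rw [hS, mem_comp] at hc
    have h5 := dist_adj_le (hc.mono hle).symm (adj_of_mem_strategy hv)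
    rw [SimpleGraph.dist_comm, SimpleGraph.dist_comm (u := c)] at h5
    exact_mod_cast h5
  rw [Finset.sum_sub_distrib, Finset.sum_const, nsmul_eq_mul] at h2 h3
  refine ⟨S, T, hu, hvT, fun c hc => ?_, hT, hcard, ?_, ?_, ?_⟩
  · rwa [hS, mem_comp] at hc
  · refine h1.trans ?_
    rw [← nsmul_eq_mul, ← Finset.sum_const]
    refine Finset.sum_le_sum fun c hc => ?_
    have hvc := (hT c hc).mono hle
    have huc : (graph s).Reachable u c := (adj_of_mem_strategy hv).reachable.trans hvc
    have hne : u ≠ c := by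
      rintro rfl
      exact hr (hT _ hc).symm
    have : (1 : ℝ) ≤ (graph s).dist u c := by exact_mod_cast huc.pos_dist_of_ne hne
    linarith
  · have : (S.card : ℝ) * (2 * (β - 1)) ≤ S.card * (S.card + 1) := by linarith
    exact le_of_mul_le_mul_left this hpos
  · linarith

/-- If `u` builds an edge to `w`, and `w` has only one further neighbour `x`, then `u` would
rather build an edge to `x`, provided that some path `u`, `w`, `x`, `y` is a geodesic. -/
theorem IsNash.false_of_swap (h : IsNash α β s) (hα : 0 < α) {u w x y : V} (hw : w ∈ (s u).1)
    (hnb : ∀ z, (graph s).Adj w z → z = u ∨ z = x) (hwx : (graph s).Adj w x)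
    (hxy : (graph s).Adj x y) (hx : 2 ≤ (graph s).dist u x) (hy : 3 ≤ (graph s).dist u y) :
    False := by
  have hux : u ≠ x := by
    rintro rfl
    simp at hx
  have huw := ne_of_mem_strategy hw
  have huw' := adj_of_mem_strategy hw
  set G := graph s with hG
  have hmove := h.le_of_move_of_comp_eq u (swapMove s u w x hux)
  set H := graph (Function.update s u (swapMove s u w x hux)) with hH
  have hadj : H.Adj u x := graph_update_adj_left.2 ⟨hux, Or.inl (Finset.mem_insert_self _ _)⟩
  have hGH : ∀ a b, G.Adj a b → ¬(a = u ∧ b = w) → ¬(a = w ∧ b = u) → H.Adj a b := by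
    intro a b hab h1 h2
    apply graph_update_adj_of_adj hab
    · rintro rfl hb
      exact Finset.mem_insert_of_mem (Finset.mem_erase.2 ⟨fun h => h1 ⟨rfl, h⟩, hb⟩)
    · rintro rfl ha
      exact Finset.mem_insert_of_mem (Finset.mem_erase.2 ⟨fun h => h2 ⟨h, rfl⟩, ha⟩)
  have hHG : ∀ a b, H.Adj a b → G.Reachable a b := by
    intro a b hab
    rcases graph_update_adj_cases hab with h1 | ⟨rfl, h1⟩ | ⟨rfl, h1⟩
    · exact h1.reachable
    · rcases Finset.mem_insert.1 h1 with rfl | h1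
      · exact huw'.reachable.trans hwx.reachable
      · exact (adj_of_mem_strategy (Finset.mem_of_mem_erase h1)).reachable
    · rcases Finset.mem_insert.1 h1 with rfl | h1
      · exact (huw'.reachable.trans hwx.reachable).symm
      · exact (adj_of_mem_strategy (Finset.mem_of_mem_erase h1)).symm.reachable
  have hHxw : H.Adj x w := hGH x w hwx.symm (fun h => hux h.1.symm) (fun h => hwx.ne h.1.symm)
  -- A geodesic from `u` through `w` can only continue to `x`, which is now adjacent to `u`; hence
  -- only `w` itself can move away.
  have hdist : ∀ k c, G.Reachable u c → G.dist u c = k → c ≠ w →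
      H.Reachable u c ∧ H.dist u c ≤ k := by
    intro k
    induction k with
    | zero =>
      intro c hc hk _
      rw [hc.dist_eq_zero_iff] at hk
      subst hk
      simp
    | succ k ih =>
      intro c hc hk hcw
      obtain ⟨b, hbc, hub, hb⟩ := exists_adj_dist_eq hc hk
      by_cases hbw : b = w
      · subst hbw
        rcases hnb c hbc with rfl | rfl
        · simp at hk
        · refine ⟨hadj.reachable, ?_⟩
          rw [SimpleGraph.dist_eq_one_iff_adj.2 hadj]
          omega
      · obtain ⟨h1, h2⟩ := ih b hub hb hbw
        have hHbc := hGH b c hbc (fun h => hcw h.2) (fun h => hbw h.1)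
        have := dist_adj_le h1 hHbc
        exact ⟨h1.trans hHbc.reachable, by omega⟩
  have hHw : H.Reachable u w := hadj.reachable.trans hHxw.reachable
  have hcomp : comp H u = comp G u := by
    ext c
    simp only [mem_comp]
    refine ⟨reachable_of_forall_adj hHG, fun hc => ?_⟩
    by_cases hcw : c = w
    · exact hcw ▸ hHw
    · exact (hdist _ c hc rfl hcw).1
  specialize hmove hcomp
  have hcard : ((swapMove s u w x hux).1.card : ℝ) ≤ (s u).1.card := by
    have h1 := Finset.card_insert_le x ((s u).1.erase w)
    rw [Finset.card_erase_add_one hw] at h1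
    exact_mod_cast h1
  have hHx : H.dist u x = 1 := SimpleGraph.dist_eq_one_iff_adj.2 hadj
  have hxw : x ≠ w := hwx.ne.symm
  have hyw : y ≠ w := by
    rintro rfl
    rw [SimpleGraph.dist_eq_one_iff_adj.2 huw'] at hy
    omega
  have hHxy := hGH x y hxy (fun h => hyw h.2) (fun h => hxw h.1)
  have hHy : H.dist u y ≤ 2 := by
    have := dist_adj_le hadj.reachable hHxy
    omega
  have hHw2 : H.dist u w ≤ 2 := by
    have := dist_adj_le hadj.reachable hHxw
    omega
  -- The distance of `w` grows from 1 to at most 2, while `x` and `y` each come closer by at least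
  -- 1: a net gain.
  have hlt : ∑ c ∈ comp G u, H.dist u c < ∑ c ∈ comp G u, G.dist u c := by
    have hwm : w ∈ comp G u := mem_comp.2 huw'.reachable
    have hxm : x ∈ (comp G u).erase w :=
      Finset.mem_erase.2 ⟨hxw, mem_comp.2 (huw'.reachable.trans hwx.reachable)⟩
    have hym : y ∈ ((comp G u).erase w).erase x := by
      refine Finset.mem_erase.2 ⟨hxy.ne.symm, Finset.mem_erase.2 ⟨hyw, ?_⟩⟩
      exact mem_comp.2 ((huw'.reachable.trans hwx.reachable).trans hxy.reachable)
    rw [← Finset.add_sum_erase _ _ hwm, ← Finset.add_sum_erase _ (fun c => G.dist u c) hwm,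
      ← Finset.add_sum_erase _ _ hxm, ← Finset.add_sum_erase _ (fun c => G.dist u c) hxm,
      ← Finset.add_sum_erase _ _ hym, ← Finset.add_sum_erase _ (fun c => G.dist u c) hym]
    have hrest : ∑ c ∈ (((comp G u).erase w).erase x).erase y, H.dist u c ≤
        ∑ c ∈ (((comp G u).erase w).erase x).erase y, G.dist u c := by
      refine Finset.sum_le_sum fun c hc => ?_
      have hc' := Finset.mem_erase.1 (Finset.mem_of_mem_erase (Finset.mem_of_mem_erase hc))
      exact (hdist _ c (mem_comp.1 hc'.2) rfl hc'.1).2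
    have hGw : G.dist u w = 1 := SimpleGraph.dist_eq_one_iff_adj.2 huw'
    omega
  have hlt' : ∑ c ∈ comp G u, (H.dist u c : ℝ) < ∑ c ∈ comp G u, (G.dist u c : ℝ) := by
    exact_mod_cast hlt
  have := mul_le_mul_of_nonneg_left hcard hα.le
  linarith

end Moves

/-! ### Penalty against diameter; leaves, short cycles and long geodesics against `α` -/

section Bounds

/-- The summand is the gain at level `i` of a geodesic of length `D` when its ends are joined. The
gains are `D - 1`, `D - 3`, ..., with sum `⌊D² / 4⌋`. -/
theorem sq_le_four_mul_sum (D : ℕ) :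
    D ^ 2 ≤ 4 * ∑ i ∈ Finset.range (D + 1), (i - (1 + (D - i))) + 1 := by
  rw [← Finset.sum_range_reflect]
  have hcongr : ∀ i ∈ Finset.range (D + 1),
      (D + 1 - 1 - i) - (1 + (D - (D + 1 - 1 - i))) = D - 1 - 2 * i := by
    intro i hi
    rw [Finset.mem_range] at hi
    omega
  rw [Finset.sum_congr rfl hcongr]
  clear hcongr
  induction D using Nat.twoStepInduction with
  | zero => simp
  | one => simp
  | more D ih _ =>
    rw [Finset.sum_range_succ', Finset.sum_range_succ]
    have : ∀ i ∈ Finset.range (D + 1), D + 2 - 1 - 2 * (i + 1) = D - 1 - 2 * i := by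
      intro i _
      omega
    rw [Finset.sum_congr rfl this]
    have h1 : D + 2 - 1 - 2 * 0 = D + 1 := by omega
    rw [h1]
    nlinarith

/-- Two neighbours `x`, `x'` of `y` that are no farther from `r` than `y` close a short cycle. -/
theorem dist_delete_le_of_two_parents {V : Type*} {G H : SimpleGraph V} {r x x' y : V} {j : ℕ}
    (hGH : ∀ a b, G.Adj a b → ¬(a = x ∧ b = y) → ¬(a = y ∧ b = x) → H.Adj a b)
    (hr : G.Reachable r y) (hx : G.Adj x y) (hx' : G.Adj x' y) (hne : x ≠ x')
    (hj : G.dist r y = j) (hxj : G.dist r x ≤ j) (hxj' : G.dist r x' ≤ j) :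
    H.Reachable x y ∧ H.dist x y ≤ 2 * j + 1 := by
  have hrx := hr.trans hx.symm.reachable
  have hrx' := hr.trans hx'.symm.reachable
  have hy := dist_adj_le hrx hx
  have h1 : H.Reachable r x ∧ H.dist r x ≤ G.dist r x := by
    rcases dist_of_delete hGH (by omega) hrx with h1 | ⟨_, h1⟩
    · exact h1
    · omega
  have h2 : H.Reachable r x' ∧ H.dist r x' ≤ G.dist r x' := by
    rcases dist_of_delete hGH (by omega) hrx' with h1 | ⟨h2, h1⟩
    · exact h1
    -- Otherwise `x'` would lie beyond `y`, at distance more than `j` from `r`.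
    · have := h2.pos_dist_of_ne hx'.ne.symm
      omega
  have hadj : H.Adj x' y := hGH x' y hx' (fun h => hne h.1.symm) (fun h => hx'.ne h.1)
  have hxx' := h1.1.symm.trans h2.1
  refine ⟨hxx'.trans hadj.reachable, ?_⟩
  have h3 := dist_adj_le hxx' hadj
  have h4 := dist_le_add h1.1.symm h2.1
  rw [SimpleGraph.dist_comm (u := x) (v := r)] at h4
  omega

theorem eq_of_reachable_of_isolated {V : Type*} {H : SimpleGraph V} {z c : V} (hz : ∀ x, ¬ H.Adj z x)
    (h : H.Reachable z c) : c = z := by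
  by_contra hne
  obtain ⟨a, b, hab, rfl, -, -⟩ := exists_boundary_adj (P := fun x => x = z) h rfl hne
  exact hz b hab

variable {V : Type*} [DecidableEq V] [Fintype V] {α β : ℝ} {s : State V}

/-- The builder finds the edge worth `α`, an outsider finds an edge to `u` not worth more than `α`;
adding the two inequalities eliminates `α`. -/
theorem IsNash.mul_card_le_of_delete (h : IsNash α β s) (hα : 0 < α) {u v w : V}
    (hv : v ∈ (s u).1) (hr : (deleteGraph s u v).Reachable u v)
    (hw : ¬ (graph s).Reachable w u) :
    (comp (graph s) u).card * (β - 1) ≤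
      ∑ c ∈ comp (graph s) u, ((deleteGraph s u v).dist u c : ℝ) := by
  have h1 := (h.le_of_delete hv hr).2
  have h2 := h.outsider_le hα hw
  rw [Finset.sum_sub_distrib, Finset.sum_const, nsmul_eq_mul] at h2
  linarith

/-- If the edge is not a bridge, the average distance after its deletion is at most `2 * d`. If it
is, the average distance from `v` to the side of `u` is at least `β - 1` and at most `d`. -/
theorem IsNash.penalty_le (h : IsNash α β s) (hα : 0 < α) {u v w : V} (hv : v ∈ (s u).1)
    (hw : ¬ (graph s).Reachable w u) {d : ℕ}
    (hd : ∀ x y, (graph s).Reachable u x → (graph s).Reachable x y → (graph s).dist x y ≤ d) :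
    β ≤ 1 + 2 * d := by
  have hle := deleteGraph_le s u v
  by_cases hr : (deleteGraph s u v).Reachable u v
  · have h1 := h.mul_card_le_of_delete hα hv hr hw
    have h2 := (h.le_of_delete hv hr).1
    have h3 : ∑ c ∈ comp (graph s) u, ((deleteGraph s u v).dist u c : ℝ) ≤
        ∑ c ∈ comp (graph s) u, (2 * d : ℝ) := by
      refine Finset.sum_le_sum fun c hc => ?_
      have hGc := mem_comp.1 hc
      rw [← h2, mem_comp] at hc
      rw [SimpleGraph.dist_comm]
      exact_mod_cast dist_delete_le_two_mul (fun x y => deleteGraph_adj) hle hc.symm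
        fun x hx => hd c x hGc hx
    rw [Finset.sum_const, nsmul_eq_mul] at h3
    have hpos : (0 : ℝ) < (comp (graph s) u).card := by exact_mod_cast one_le_card_comp _ u
    have := le_of_mul_le_mul_left (h1.trans h3) hpos
    linarith
  · obtain ⟨S, T, hu, -, hS, -, -, -, h2, -⟩ := h.bridge hα hv hr hw
    have h3 : ∑ c ∈ S, (β - 1 - (d : ℝ)) ≤ ∑ c ∈ S, (β - 1 - ((graph s).dist v c : ℝ)) := by
      refine Finset.sum_le_sum fun c hc => ?_
      rw [hS, mem_comp] at hc
      have huv := (adj_of_mem_strategy hv).reachable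
      have : ((graph s).dist v c : ℝ) ≤ d := by
        exact_mod_cast hd v c huv (huv.symm.trans (hc.mono hle))
      linarith
    rw [Finset.sum_const, nsmul_eq_mul] at h3
    have hpos : (0 : ℝ) < S.card := by exact_mod_cast Finset.card_pos.2 ⟨u, hu⟩
    have h4 : (S.card : ℝ) * (β - 1 - d) ≤ S.card * 0 := by linarith
    have := le_of_mul_le_mul_left h4 hpos
    have : (0 : ℝ) ≤ d := d.cast_nonneg
    linarith

/-- If `x` buys an edge to `y`, it suffices to count the gain at one vertex per level, each on some
geodesic from `x` to `y`. -/
theorem IsNash.dist_sq_le (h : IsNash α β s) (hα : 0 < α) {x y : V}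
    (hxy : (graph s).Reachable x y) : ((graph s).dist x y : ℝ) ^ 2 ≤ 4 * α + 1 := by
  by_cases hne : x = y
  · subst hne
    simp
    linarith
  have h1 := h.insider_le hα hxy hne
  set D := (graph s).dist x y with hD
  have : Nonempty V := ⟨x⟩
  choose! c hc hc1 hc2 using exists_dist_eq hxy
  have hinj : Set.InjOn c (Finset.range (D + 1) : Set ℕ) := by
    intro i hi j hj hij
    simp only [Finset.coe_range, Set.mem_Iio] at hi hj
    rw [← hc1 i (by omega), ← hc1 j (by omega), hij]
  have h2 : ∑ i ∈ Finset.range (D + 1), (i - (1 + (D - i))) ≤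
      ∑ z ∈ comp (graph s) x, ((graph s).dist x z - (1 + (graph s).dist y z)) := by
    calc _ = ∑ i ∈ Finset.range (D + 1),
          ((graph s).dist x (c i) - (1 + (graph s).dist y (c i))) := by
          refine Finset.sum_congr rfl fun i hi => ?_
          rw [Finset.mem_range] at hi
          rw [hc1 i (by omega), SimpleGraph.dist_comm (u := y), hc2 i (by omega)]
      _ = ∑ z ∈ (Finset.range (D + 1)).image c,
          ((graph s).dist x z - (1 + (graph s).dist y z)) :=
          (Finset.sum_image (f := fun z => (graph s).dist x z - (1 + (graph s).dist y z)) hinj).symm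
      _ ≤ _ := by
          refine Finset.sum_le_sum_of_subset fun z hz => ?_
          obtain ⟨i, hi, rfl⟩ := Finset.mem_image.1 hz
          rw [Finset.mem_range] at hi
          exact mem_comp.2 (hc i (by omega))
  have h3 := (sq_le_four_mul_sum D).trans (Nat.add_le_add_right (Nat.mul_le_mul_left 4 h2) 1)
  have h4 : (D : ℝ) ^ 2 ≤ 4 * ∑ z ∈ comp (graph s) x,
      (((graph s).dist x z - (1 + (graph s).dist y z) : ℕ) : ℝ) + 1 := by exact_mod_cast h3
  linarith

theorem IsNash.not_mem_strategy_of_mem (h : IsNash α β s) (hα : 0 < α) {u v : V}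
    (hv : v ∈ (s u).1) : u ∉ (s v).1 := by
  intro hu
  have hne := ne_of_mem_strategy hv
  have hadj : (deleteGraph s u v).Adj u v := graph_update_adj_left.2 ⟨hne, Or.inr hu⟩
  have heq : deleteGraph s u v = graph s := by
    apply le_antisymm (deleteGraph_le s u v)
    intro x y hxy
    by_cases h1 : x = u ∧ y = v
    · obtain ⟨rfl, rfl⟩ := h1
      exact hadj
    · by_cases h2 : x = v ∧ y = u
      · obtain ⟨rfl, rfl⟩ := h2
        exact hadj.symm
      · exact deleteGraph_adj hxy h1 h2
  have h1 := (h.le_of_delete hv hadj.reachable).2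
  rw [heq] at h1
  linarith

theorem IsNash.not_deleteGraph_adj (h : IsNash α β s) (hα : 0 < α) {u v : V}
    (hv : v ∈ (s u).1) : ¬ (deleteGraph s u v).Adj u v := by
  intro hadj
  rcases (graph_update_adj_left.1 hadj).2 with h1 | h1
  · exact Finset.notMem_erase v _ h1
  · exact h.not_mem_strategy_of_mem hα hv h1

/-- The edge at a leaf `z` is a bridge, which isolates `z`. -/
theorem IsNash.bridge_of_leaf (h : IsNash α β s) (hα : 0 < α) {z y : V} (hzy : (graph s).Adj z y)
    (hz : ∀ x, (graph s).Adj z x → x = y) :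
    ∃ u v, v ∈ (s u).1 ∧ (u = z ∨ v = z) ∧ ¬ (deleteGraph s u v).Reachable u v ∧
      (graph s).Reachable z u ∧ ∀ c, (deleteGraph s u v).Reachable z c → c = z := by
  rcases (graph_adj.1 hzy).2 with hy | hy
  · have hiso : ∀ x, ¬ (deleteGraph s z y).Adj z x := by
      intro x hx
      obtain rfl := hz x (deleteGraph_le s z y hx)
      exact h.not_deleteGraph_adj hα hy hx
    exact ⟨z, y, hy, Or.inl rfl, fun hr => hzy.ne (eq_of_reachable_of_isolated hiso hr).symm,
      by rfl, fun c => eq_of_reachable_of_isolated hiso⟩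
  · have hiso : ∀ x, ¬ (deleteGraph s y z).Adj z x := by
      intro x hx
      obtain rfl := hz x (deleteGraph_le s y z hx)
      exact h.not_deleteGraph_adj hα hy hx.symm
    exact ⟨y, z, hy, Or.inr rfl, fun hr => hzy.ne (eq_of_reachable_of_isolated hiso hr.symm).symm,
      hzy.reachable, fun c => eq_of_reachable_of_isolated hiso⟩

/-- One side of the bridge at `z` is `{z}`. If `z` builds it, then `β - 1 ≤ 1` and `α ≤ |T|`;
otherwise `α ≤ β - 1 ≤ (|S| + 1) / 2`. -/
theorem IsNash.cost_le_of_leaf (h : IsNash α β s) (hα : 0 < α) {z y w : V}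
    (hzy : (graph s).Adj z y) (hz : ∀ x, (graph s).Adj z x → x = y)
    (hw : ¬ (graph s).Reachable w z) : α ≤ (comp (graph s) z).card := by
  obtain ⟨u, v, hv, huv, hr, hzu, hiso⟩ := h.bridge_of_leaf hα hzy hz
  obtain ⟨S, T, hu, hvT, hS, hT, hcard, h1, h2, -⟩ :=
    h.bridge_card hα hv hr fun h' => hw (h'.trans hzu.symm)
  rw [comp_congr hzu, ← hcard]
  push_cast
  have hS1 : (1 : ℝ) ≤ S.card := by exact_mod_cast Finset.card_pos.2 ⟨u, hu⟩
  have hT1 : (1 : ℝ) ≤ T.card := by exact_mod_cast Finset.card_pos.2 ⟨v, hvT⟩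
  rcases huv with rfl | rfl
  · have : S.card ≤ 1 := Finset.card_le_one.2 fun a ha b hb =>
      (hiso a (hS a ha)).trans (hiso b (hS b hb)).symm
    have : (S.card : ℝ) ≤ 1 := by exact_mod_cast this
    nlinarith
  · have : T.card ≤ 1 := Finset.card_le_one.2 fun a ha b hb =>
      (hiso a (hT a ha)).trans (hiso b (hT b hb)).symm
    have : (T.card : ℝ) ≤ 1 := by exact_mod_cast this
    nlinarith

/-- Without the edge, the detour around the cycle lengthens each distance from `u` by at most `k`.
-/
theorem IsNash.cost_le_of_cycle (h : IsNash α β s) {u v : V} (hv : v ∈ (s u).1)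
    (hr : (deleteGraph s u v).Reachable u v) {k : ℕ}
    (hk : (deleteGraph s u v).dist u v ≤ k + 1) : α ≤ (comp (graph s) u).card * k := by
  have h1 := (h.le_of_delete hv hr).2
  have h2 : ∑ c ∈ comp (graph s) u, ((deleteGraph s u v).dist u c : ℝ) ≤
      ∑ c ∈ comp (graph s) u, (((graph s).dist u c : ℝ) + k) := by
    refine Finset.sum_le_sum fun c hc => ?_
    rcases dist_of_delete (H := deleteGraph s u v) (a := u) (b := v)
      (fun x y => deleteGraph_adj) (by simp) (mem_comp.1 hc) with h3 | h3
    · exact_mod_cast h3.2.trans (Nat.le_add_right _ _)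
    · have h4 := dist_le_add hr h3.1
      have h5 := h3.2
      rw [SimpleGraph.dist_self] at h5
      exact_mod_cast (by omega : (deleteGraph s u v).dist u c ≤ (graph s).dist u c + k)
  rw [Finset.sum_add_distrib, Finset.sum_const, nsmul_eq_mul] at h2
  linarith

theorem IsNash.cost_le_of_two_parents (h : IsNash α β s) {r x x' y : V}
    (hr : (graph s).Reachable r y) (hx : (graph s).Adj x y) (hx' : (graph s).Adj x' y)
    (hne : x ≠ x') (hxj : (graph s).dist r x ≤ (graph s).dist r y)
    (hxj' : (graph s).dist r x' ≤ (graph s).dist r y) :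
    α ≤ (comp (graph s) r).card * (2 * (graph s).dist r y : ℕ) := by
  rcases (graph_adj.1 hx).2 with hb | hb
  · rw [comp_congr (hr.trans hx.symm.reachable)]
    obtain ⟨h1, h2⟩ := dist_delete_le_of_two_parents (H := deleteGraph s x y)
      (fun a b => deleteGraph_adj) hr hx hx' hne rfl hxj hxj'
    exact h.cost_le_of_cycle hb h1 h2
  · rw [comp_congr hr]
    obtain ⟨h1, h2⟩ := dist_delete_le_of_two_parents (H := deleteGraph s y x)
      (fun a b hab ha hb => deleteGraph_adj hab hb ha) hr hx hx' hne rfl hxj hxj'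
    refine h.cost_le_of_cycle hb h1.symm ?_
    rwa [SimpleGraph.dist_comm]

end Bounds

/-! ### Exponential growth of breadth-first levels -/

section Growth

variable {V : Type*}

/-- In a graph without leaves and without short cycles through its geodesics, in which one of the
two endpoints of each edge has two further neighbours, every vertex has two grandchildren. -/
theorem exists_two_grandchildren {G : SimpleGraph V} {r a : V} {J : ℕ}
    (huniq : ∀ y x x', G.Reachable r y → G.dist r y ≤ J → G.Adj x y → G.Adj x' y →
      G.dist r x ≤ G.dist r y → G.dist r x' ≤ G.dist r y → x = x')
    (hdeg : ∀ x y, G.Reachable r x → G.Adj x y → ∃ z, G.Adj x z ∧ z ≠ y)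
    (hedge : ∀ x y, G.Reachable r x → G.Adj x y →
      (∃ z z', z ≠ z' ∧ z ≠ y ∧ z' ≠ y ∧ G.Adj x z ∧ G.Adj x z') ∨
      (∃ z z', z ≠ z' ∧ z ≠ x ∧ z' ≠ x ∧ G.Adj y z ∧ G.Adj y z'))
    (ha : G.Reachable r a) (hadj : ∃ p, G.Adj a p) (hJ : G.dist r a + 2 ≤ J) :
    ∃ c c' b b', b ≠ b' ∧ G.Adj a c ∧ G.Adj c b ∧ G.Adj a c' ∧ G.Adj c' b' ∧
      G.dist r c = G.dist r a + 1 ∧ G.dist r c' = G.dist r a + 1 ∧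
      G.dist r b = G.dist r a + 2 ∧ G.dist r b' = G.dist r a + 2 := by
  have hchild : ∀ x p q, G.Reachable r x → G.dist r x ≤ J → G.Adj x p → G.Adj x q → p ≠ q →
      G.dist r p ≤ G.dist r x → G.dist r q = G.dist r x + 1 := by
    intro x p q hx hxJ hp hq hne hpx
    have h1 := dist_adj_le hx hq
    by_contra hcon
    exact hne (huniq x p q hx hxJ hp.symm hq.symm hpx (by omega))
  have hsome : ∀ p q, G.Adj a p → G.Adj a q → p ≠ q →
      G.dist r p = G.dist r a + 1 ∨ G.dist r q = G.dist r a + 1 := by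
    intro p q hp hq hne
    have h1 := dist_adj_le ha hp
    by_cases hpa : G.dist r p ≤ G.dist r a
    · exact Or.inr (hchild a p q ha (by omega) hp hq hne hpa)
    · left
      omega
  have hgrand : ∀ c b, G.Adj a c → G.dist r c = G.dist r a + 1 → G.Adj c b → b ≠ a →
      G.dist r b = G.dist r a + 2 := by
    intro c b hc hcd hcb hba
    rw [hchild c a b (ha.trans hc.reachable) (by omega) hc.symm hcb hba.symm (by omega), hcd]
  obtain ⟨p, hp⟩ := hadj
  obtain ⟨q, hq, hqp⟩ := hdeg a p ha hp
  obtain ⟨c, hc, hcd⟩ : ∃ c, G.Adj a c ∧ G.dist r c = G.dist r a + 1 := by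
    rcases hsome p q hp hq hqp.symm with h1 | h1
    · exact ⟨p, hp, h1⟩
    · exact ⟨q, hq, h1⟩
  -- If `a` has two neighbours besides `c`, one of them is a second child, and each child has its
  -- own child. Otherwise `c` has two neighbours besides `a`, both grandchildren of `a`. Only one
  -- end of an edge is known to branch, hence the step of two levels.
  rcases hedge a c ha hc with ⟨z, z', hne, hzc, hzc', hz, hz'⟩ | ⟨z, z', hne, hza, hza', hz, hz'⟩
  · obtain ⟨c', hc', hcd', hcc'⟩ : ∃ c', G.Adj a c' ∧ G.dist r c' = G.dist r a + 1 ∧ c' ≠ c := by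
      rcases hsome z z' hz hz' hne with h1 | h1
      · exact ⟨z, hz, h1, hzc⟩
      · exact ⟨z', hz', h1, hzc'⟩
    obtain ⟨b, hb, hba⟩ := hdeg c a (ha.trans hc.reachable) hc.symm
    obtain ⟨b', hb', hba'⟩ := hdeg c' a (ha.trans hc'.reachable) hc'.symm
    have hbd := hgrand c b hc hcd hb hba
    have hbd' := hgrand c' b' hc' hcd' hb' hba'
    refine ⟨c, c', b, b', ?_, hc, hb, hc', hb', hcd, hcd', hbd, hbd'⟩
    rintro rfl
    exact hcc' (huniq b c' c ((ha.trans hc.reachable).trans hb.reachable) (by omega) hb' hb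
      (by omega) (by omega))
  · exact ⟨c, c, z, z', hne, hc, hz, hc, hz', hcd, hcd, hgrand c z hc hcd hz hza,
      hgrand c z' hc hcd hz' hza'⟩

open Classical in
-- Double counting of the grandparent relation between consecutive even levels: at least two
-- grandchildren each, at most one grandparent each.
theorem two_pow_le_card_comp [Fintype V] {G : SimpleGraph V} {r : V} {J : ℕ}
    (huniq : ∀ y x x', G.Reachable r y → G.dist r y ≤ J → G.Adj x y → G.Adj x' y →
      G.dist r x ≤ G.dist r y → G.dist r x' ≤ G.dist r y → x = x')
    (hdeg : ∀ x y, G.Reachable r x → G.Adj x y → ∃ z, G.Adj x z ∧ z ≠ y)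
    (hedge : ∀ x y, G.Reachable r x → G.Adj x y →
      (∃ z z', z ≠ z' ∧ z ≠ y ∧ z' ≠ y ∧ G.Adj x z ∧ G.Adj x z') ∨
      (∃ z z', z ≠ z' ∧ z ≠ x ∧ z' ≠ x ∧ G.Adj y z ∧ G.Adj y z'))
    (hadj : ∀ a, G.Reachable r a → ∃ p, G.Adj a p) (k : ℕ) (hk : 2 * k ≤ J) :
    2 ^ k ≤ (comp G r).card := by
  suffices h : ∀ k, 2 * k ≤ J → 2 ^ k ≤ ((comp G r).filter (G.dist r · = 2 * k)).card from
    (h k hk).trans (Finset.card_filter_le _ _)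
  intro k
  induction k with
  | zero =>
    intro _
    refine Finset.card_pos.2 ⟨r, ?_⟩
    simp
  | succ k ih =>
    intro hkJ
    have h1 := ih (by omega)
    have h2 := Finset.card_mul_le_card_mul (m := 2) (n := 1)
      (s := (comp G r).filter (G.dist r · = 2 * k))
      (t := (comp G r).filter (G.dist r · = 2 * (k + 1)))
      (fun a b => ∃ c, G.Adj a c ∧ G.Adj c b ∧ G.dist r c = 2 * k + 1) ?_ ?_
    · rw [pow_succ]
      omega
    · intro a ha
      rw [Finset.mem_filter, mem_comp] at ha
      obtain ⟨c, c', b, b', hne, hc, hb, hc', hb', hcd, hcd', hbd, hbd'⟩ :=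
        exists_two_grandchildren huniq hdeg hedge ha.1 (hadj a ha.1) (by omega)
      rw [ha.2] at hcd hcd' hbd hbd'
      refine Finset.one_lt_card.2 ⟨b, ?_, b', ?_, hne⟩
      · rw [Finset.mem_bipartiteAbove, Finset.mem_filter, mem_comp]
        exact ⟨⟨(ha.1.trans hc.reachable).trans hb.reachable, by omega⟩, c, hc, hb, hcd⟩
      · rw [Finset.mem_bipartiteAbove, Finset.mem_filter, mem_comp]
        exact ⟨⟨(ha.1.trans hc'.reachable).trans hb'.reachable, by omega⟩, c', hc', hb', hcd'⟩
    · intro b hb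
      rw [Finset.mem_filter, mem_comp] at hb
      refine Finset.card_le_one.2 fun a ha a' ha' => ?_
      rw [Finset.mem_bipartiteBelow, Finset.mem_filter, mem_comp] at ha ha'
      obtain ⟨⟨har, had⟩, c, hac, hcb, hcd⟩ := ha
      obtain ⟨⟨har', had'⟩, c', hac', hcb', hcd'⟩ := ha'
      obtain rfl := huniq b c c' hb.1 (by omega) hcb hcb' (by omega) (by omega)
      exact huniq c a a' (har.trans hac.reachable) (by omega) hac hac' (by omega) (by omega)

end Growth

/-! ### The logarithmic bound on `α`, and the penalty below `n / 2` -/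

section Bounds

variable {V : Type*} [DecidableEq V] [Fintype V] {α β : ℝ} {s : State V}

theorem IsNash.lt_two_pow (h : IsNash α β s) (hα : 0 < α) {r q w : V} (hrq : (graph s).Adj r q)
    (hw : ¬ (graph s).Reachable w r) {k : ℕ} (hk : 1 ≤ k)
    (hle : (comp (graph s) r).card * (4 * k : ℝ) < α) : 2 ^ k ≤ (comp (graph s) r).card := by
  set G := graph s with hG
  -- Parents must be unique as seen from every `u` of the component, not just from `r`: the swap
  -- below is judged by the builder of the edge.
  have huniq : ∀ u, G.Reachable r u → ∀ y x x', G.Reachable u y → G.dist u y ≤ 2 * k →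
      G.Adj x y → G.Adj x' y → G.dist u x ≤ G.dist u y → G.dist u x' ≤ G.dist u y → x = x' := by
    intro u hu y x x' hy hyJ hx hx' hxy hxy'
    by_contra hne
    have h1 := h.cost_le_of_two_parents hy hx hx' hne hxy hxy'
    rw [← hG, ← comp_congr hu] at h1
    have h2 : ((2 * G.dist u y : ℕ) : ℝ) ≤ 4 * k := by exact_mod_cast (by omega)
    have := mul_le_mul_of_nonneg_left h2 (comp G r).card.cast_nonneg (α := ℝ)
    linarith
  have hcard : ((comp G r).card : ℝ) < α := by
    refine lt_of_le_of_lt ?_ hle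
    have : (1 : ℝ) ≤ 4 * k := by exact_mod_cast (by omega)
    exact le_mul_of_one_le_right (Nat.cast_nonneg _) this
  have hdeg : ∀ x y, G.Reachable r x → G.Adj x y → ∃ z, G.Adj x z ∧ z ≠ y := by
    intro x y hx hxy
    by_contra! hcon
    have h1 := h.cost_le_of_leaf hα hxy hcon fun h' => hw (h'.trans hx.symm)
    rw [← hG, ← comp_congr hx] at h1
    linarith
  have hbuy : ∀ u v, G.Reachable r u → v ∈ (s u).1 →
      ∃ z z', z ≠ z' ∧ z ≠ u ∧ z' ≠ u ∧ G.Adj v z ∧ G.Adj v z' := by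
    intro u v hu hv
    have huv : G.Adj u v := adj_of_mem_strategy hv
    have huv' := hu.trans huv.reachable
    obtain ⟨x, hx, hxu⟩ := hdeg v u huv' huv.symm
    by_contra! hcon
    have hnb : ∀ z, G.Adj v z → z = u ∨ z = x := by
      intro z hz
      by_contra! hz'
      exact hcon x z hz'.2.symm hxu hz'.1 hx hz
    have hd1 : G.dist u v = 1 := SimpleGraph.dist_eq_one_iff_adj.2 huv
    have hx2 : 2 ≤ G.dist u x := by
      by_contra! hlt
      have := huniq u hu v u x huv.reachable (by omega) huv hx.symm (by simp) (by omega)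
      exact hxu this.symm
    have hx2' : G.dist u x ≤ 2 := by
      have := dist_adj_le huv.reachable hx
      omega
    obtain ⟨y, hy, hyv⟩ := hdeg x v (huv'.trans hx.reachable) hx.symm
    have hy3 : 3 ≤ G.dist u y := by
      by_contra! hlt
      exact hyv (huniq u hu x y v (huv.reachable.trans hx.reachable) (by omega) hy.symm hx
        (by omega) (by omega))
    exact h.false_of_swap hα hv hnb hx hy hx2 hy3
  refine two_pow_le_card_comp (J := 2 * k) (huniq r (by rfl)) hdeg ?_ ?_ k le_rfl
  · intro x y hx hxy
    rcases (graph_adj.1 hxy).2 with h1 | h1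
    · exact Or.inr (hbuy x y hx h1)
    · exact Or.inl (hbuy y x (hx.trans hxy.reachable) h1)
  · intro a ha
    by_cases har : a = r
    · exact ⟨q, har ▸ hrq⟩
    · obtain ⟨b, c, hbc, hb, hc, -⟩ := exists_boundary_adj (P := fun x => x ≠ a) ha
        (Ne.symm har) (by simp)
      obtain rfl := not_not.1 hc
      exact ⟨b, hbc.symm⟩

theorem IsNash.cost_lt (h : IsNash α β s) (hα : 0 < α) {r q w : V} (hrq : (graph s).Adj r q)
    (hw : ¬ (graph s).Reachable w r) :
    α < 12 * (comp (graph s) r).card * Real.log (comp (graph s) r).card := by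
  have hn : 2 ≤ (comp (graph s) r).card :=
    Finset.one_lt_card.2 ⟨r, by simp, q, mem_comp.2 hrq.reachable, hrq.ne⟩
  have key := h.lt_two_pow hα hrq hw (k := Nat.log 2 (comp (graph s) r).card + 1) (by omega)
  generalize (comp (graph s) r).card = n at hn key
  by_contra! hcon
  have hlt : n < 2 ^ (Nat.log 2 n + 1) := Nat.lt_pow_succ_log_self one_lt_two n
  refine absurd (key ?_) (not_le.2 hlt)
  -- The exponent `k` satisfies `n < 2 ^ k ≤ 2 * n ≤ n ^ 2`, so `4 * k ≤ 8 * log n / log 2`, and `8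
  -- / log 2 < 12`.
  have h1 : (2 : ℝ) ^ (Nat.log 2 n + 1) ≤ (n : ℝ) ^ 2 := by
    have h2 := Nat.pow_log_le_self 2 (by omega : n ≠ 0)
    have : 2 ^ (Nat.log 2 n + 1) ≤ n ^ 2 := by
      rw [pow_succ, pow_two]
      exact Nat.mul_le_mul h2 hn
    exact_mod_cast this
  have h3 := Real.log_le_log (by positivity) h1
  rw [Real.log_pow, Real.log_pow] at h3
  have hlog2 := Real.log_two_gt_d9
  have hn' : (2 : ℝ) ≤ n := by exact_mod_cast hn
  have hlogn : Real.log 2 ≤ Real.log n := Real.log_le_log (by norm_num) hn'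
  have hkpos : (0 : ℝ) < ((Nat.log 2 n + 1 : ℕ) : ℝ) := by positivity
  generalize ((Nat.log 2 n + 1 : ℕ) : ℝ) = k at h3 hkpos
  have h4 : 4 * k < 12 * Real.log n := by
    push_cast at h3
    nlinarith
  calc (n : ℝ) * (4 * k) < n * (12 * Real.log n) := by gcongr
    _ = 12 * n * Real.log n := by ring
    _ ≤ α := hcon

theorem IsNash.penalty_lt_of_bridge (h : IsNash α β s) (hα : 0 < α) {u v w : V}
    (hv : v ∈ (s u).1) (hr : ¬ (deleteGraph s u v).Reachable u v)
    (hw : ¬ (graph s).Reachable w u) (hn : 6 < Fintype.card V) :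
    β < (Fintype.card V : ℝ) / 2 := by
  obtain ⟨S, T, hu, hvT, -, -, hcard, -, h1, h2⟩ := h.bridge_card hα hv hr hw
  have hlt : (comp (graph s) u).card + 1 ≤ Fintype.card V := by
    rw [← Finset.card_univ]
    exact Finset.card_lt_card (Finset.ssubset_univ_iff.2 fun heq =>
      hw (mem_comp.1 (heq ▸ Finset.mem_univ w : w ∈ comp (graph s) u)).symm)
  rw [← hcard] at hlt
  have hS : 1 ≤ S.card := Finset.card_pos.2 ⟨u, hu⟩
  have hT : 1 ≤ T.card := Finset.card_pos.2 ⟨v, hvT⟩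
  have hlt' : (S.card : ℝ) + T.card + 1 ≤ Fintype.card V := by exact_mod_cast hlt
  have hn' : (7 : ℝ) ≤ Fintype.card V := by exact_mod_cast hn
  have hT' : (1 : ℝ) ≤ T.card := by exact_mod_cast hT
  have hS' : (1 : ℝ) ≤ S.card := by exact_mod_cast hS
  by_contra! hcon
  -- A small `S` gives `β ≤ 5 / 2 < 7 / 2`. Otherwise `β ≥ n / 2` and `n ≥ |S| + |T| + 1` turn `h2`
  -- into `|S| * |T| ≤ 2 * |T|`.
  by_cases h3 : S.card ≤ 2
  · have : (S.card : ℝ) ≤ 2 := by exact_mod_cast h3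
    linarith
  · have : (3 : ℝ) ≤ S.card := by exact_mod_cast (by omega : 3 ≤ S.card)
    nlinarith

theorem IsNash.penalty_lt (h : IsNash α β s) (hα : 0 < α) {u v w : V}
    (hv : v ∈ (s u).1) (hw : ¬ (graph s).Reachable w u) (hn : 6 < Fintype.card V) :
    β < (Fintype.card V : ℝ) / 2 := by
  by_cases hr : (deleteGraph s u v).Reachable u v
  swap
  · exact h.penalty_lt_of_bridge hα hv hr hw hn
  have hle := deleteGraph_le s u v
  have h1 := h.mul_card_le_of_delete hα hv hr hw
  have hcomp := (h.le_of_delete hv hr).1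
  have h2 := two_mul_sum_dist_le (deleteGraph s u v) u
  obtain ⟨-, hinj⟩ := sum_downward_closed _ _ (comp_dist_downward_closed (deleteGraph s u v) u)
  set H := deleteGraph s u v with hH
  rw [← hcomp] at h1
  have hpos := one_le_card_comp H u
  have hpos' : (1 : ℝ) ≤ (comp H u).card := by exact_mod_cast hpos
  have hlt : (comp H u).card + 1 ≤ Fintype.card V := by
    rw [← Finset.card_univ]
    exact Finset.card_lt_card (Finset.ssubset_univ_iff.2 fun heq =>
      hw ((mem_comp.1 (heq ▸ Finset.mem_univ w : w ∈ comp H u)).mono hle).symm)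
  have hlt' : ((comp H u).card : ℝ) + 1 ≤ Fintype.card V := by exact_mod_cast hlt
  by_contra! hcon
  -- If `β ≥ n / 2`, every estimate is tight: the component has `n - 1` vertices and `H` is a path
  -- on it starting at `u`.
  have h3 : (comp H u).card * ((comp H u).card - 1 : ℝ) ≤ 2 * ∑ c ∈ comp H u, (H.dist u c : ℝ) := by
    nlinarith
  have hm : 6 ≤ (comp H u).card := by
    have h4 : ((comp H u).card : ℝ) * (2 * (β - 1)) ≤ (comp H u).card * ((comp H u).card - 1) := by
      linarith
    have h5 := le_of_mul_le_mul_left h4 (by linarith)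
    have : (Fintype.card V : ℝ) ≤ (comp H u).card + 1 := by linarith
    have : Fintype.card V ≤ (comp H u).card + 1 := by exact_mod_cast this
    omega
  obtain ⟨hinj, hsurj⟩ := hinj (by
    have h4 := le_antisymm h2 h3
    have : ((2 * ∑ x ∈ comp H u, H.dist u x : ℕ) : ℝ) =
        (((comp H u).card * ((comp H u).card - 1) : ℕ) : ℝ) := by
      push_cast [hpos]
      exact h4
    exact_mod_cast this)
  generalize hmdef : (comp H u).card = m at hm hsurj
  have hmax : ∀ c ∈ comp H u, H.dist u c ≤ m - 1 := by
    intro c hc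
    have hsub : Finset.range (H.dist u c + 1) ⊆ (comp H u).image (H.dist u) := by
      intro i hi
      obtain ⟨y, hy, hyi⟩ := comp_dist_downward_closed H u c hc i
        (Nat.lt_succ_iff.1 (Finset.mem_range.1 hi))
      exact Finset.mem_image.2 ⟨y, hy, hyi⟩
    have := (Finset.card_le_card hsub).trans Finset.card_image_le
    rw [Finset.card_range] at this
    omega
  obtain ⟨z, hz, hzd⟩ := hsurj (m - 1) (by omega)
  obtain ⟨x, hxz, hux, hxd⟩ := exists_adj_dist_eq (k := m - 2) (mem_comp.1 hz) (by omega)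
  have hznb : ∀ c, H.Adj z c → c = x := by
    intro c hc
    have hcm := (mem_comp.1 hz).trans hc.reachable
    have h4 := dist_adj_le hcm hc.symm
    have h5 := hmax c (mem_comp.2 hcm)
    refine hinj (mem_comp.2 hcm) (mem_comp.2 hux) ?_
    have h6 : H.dist u c ≠ m - 1 := fun h7 =>
      hc.ne (hinj hz (mem_comp.2 hcm) (by rw [hzd, h7]))
    omega
  have hzu : z ≠ u := by
    rintro rfl
    rw [SimpleGraph.dist_self] at hzd
    omega
  -- The path ends at `z`. If `z = v`, the edge `uv` closes it to a cycle, on which `u` prefers to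
  -- swap; there `m ≥ 6` makes `y` at distance at least 3 both ways around. If `z ≠ v`, then `z` is
  -- a leaf of `graph s` and the bridge case applies.
  by_cases hzv : z = v
  · subst hzv
    obtain ⟨y, hyx, huy, hyd⟩ := exists_adj_dist_eq (k := m - 3) hux (by omega)
    have hdich : ∀ c, H.Reachable u c → H.dist u c ≤ (graph s).dist u c ∨
        1 + H.dist z c ≤ (graph s).dist u c := by
      intro c hc
      have := dist_of_delete (H := H) (a := u) (b := z) (fun x y => deleteGraph_adj) (by simp)
        (hc.mono hle)
      rw [SimpleGraph.dist_self] at this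
      rcases this with h4 | h4
      · exact Or.inl h4.2
      · exact Or.inr (by omega)
    have hzc : ∀ c, H.Reachable u c → H.dist u z ≤ H.dist u c + H.dist z c := by
      intro c hc
      have := dist_le_add hc (hc.symm.trans hr)
      rwa [SimpleGraph.dist_comm (u := c)] at this
    refine h.false_of_swap hα hv (x := x) (y := y) ?_ (hle hxz.symm) (hle hyx.symm) ?_ ?_
    · intro c hc
      by_cases hcu : c = u
      · exact Or.inl hcu
      · exact Or.inr (hznb c (deleteGraph_adj hc (fun h => hzu h.1) (fun h => hcu h.2)))
    · have := hzc x hux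
      rcases hdich x hux with h4 | h4 <;> omega
    · have := hzc y huy
      rcases hdich y huy with h4 | h4 <;> omega
  · obtain ⟨u', v', hv', -, hr', hzu', -⟩ := h.bridge_of_leaf hα (hle hxz.symm) fun c hc =>
      hznb c (deleteGraph_adj hc (fun h => hzu h.1) (fun h => hzv h.1))
    have huz := (mem_comp.1 hz).mono hle
    exact absurd (h.penalty_lt_of_bridge hα hv' hr'
      (fun h' => hw (h'.trans (huz.trans hzu').symm)) hn) (not_lt.2 hcon)

end Bounds

/-! ### Components as induced graphs -/

section Components

variable {V : Type*}

theorem mem_supp_of_reachable {G : SimpleGraph V} {C : G.ConnectedComponent} {x y : V}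
    (hx : x ∈ C.supp) (h : G.Reachable x y) : y ∈ C.supp := by
  rw [SimpleGraph.ConnectedComponent.mem_supp_iff] at hx ⊢
  rw [← hx]
  exact SimpleGraph.ConnectedComponent.sound h.symm

theorem dist_toSimpleGraph {G : SimpleGraph V} (C : G.ConnectedComponent) (x y : C) :
    C.toSimpleGraph.dist x y = G.dist x y := by
  apply le_antisymm
  · obtain ⟨k, hk⟩ : ∃ k, G.dist (x : V) y = k := ⟨_, rfl⟩
    have hxy : G.Reachable (x : V) y := C.reachable_of_mem_supp x.2 y.2
    rw [hk]
    obtain ⟨y, hy⟩ := y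
    induction k generalizing y with
    | zero =>
      rw [hxy.dist_eq_zero_iff] at hk
      obtain rfl : x = ⟨y, hy⟩ := Subtype.ext hk
      simp
    | succ k ih =>
      obtain ⟨b, hby, hxb, hb⟩ := exists_adj_dist_eq hxy hk
      have hbC : b ∈ C.supp := mem_supp_of_reachable hy hby.symm.reachable
      have h1 := ih b hbC hb hxb
      have h2 : C.toSimpleGraph.Adj ⟨b, hbC⟩ ⟨y, hy⟩ := (C.toSimpleGraph_adj hbC hy).2 hby
      exact (dist_adj_le (C.connected_toSimpleGraph.preconnected _ _) h2).trans (by omega)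
  · obtain ⟨p, hp⟩ := (C.connected_toSimpleGraph.preconnected x y).exists_walk_length_eq_dist
    rw [← hp, ← SimpleGraph.Walk.length_map C.toSimpleGraph_hom]
    exact SimpleGraph.dist_le _

theorem exists_mem_strategy_of_nontrivial {s : State V} {C : (graph s).ConnectedComponent}
    (hC : C.supp.Nontrivial) : ∃ u v, v ∈ (s u).1 ∧ u ∈ C.supp := by
  obtain ⟨x, hx, y, hy, hne⟩ := hC
  obtain ⟨a, b, hab, rfl, -, -⟩ := exists_boundary_adj (P := fun z => z = x)
    (C.reachable_of_mem_supp hx hy) rfl hne.symm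
  rcases (graph_adj.1 hab).2 with h1 | h1
  · exact ⟨a, b, h1, hx⟩
  · exact ⟨b, a, h1, mem_supp_of_reachable hx hab.reachable⟩

theorem ncard_supp_eq_card_comp [Fintype V] {G : SimpleGraph V} {C : G.ConnectedComponent} {x : V}
    (hx : x ∈ C.supp) : C.supp.ncard = (comp G x).card := by
  rw [← Set.ncard_coe_finset]
  congr 1
  ext y
  rw [Finset.mem_coe, mem_comp]
  exact ⟨fun hy => C.reachable_of_mem_supp hx hy, mem_supp_of_reachable hx⟩

theorem dist_le_diam_toSimpleGraph [Finite V] {G : SimpleGraph V} {C : G.ConnectedComponent}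
    {x y : V} (hx : x ∈ C.supp) (hy : y ∈ C.supp) : G.dist x y ≤ C.toSimpleGraph.diam := by
  have : Nonempty C := ⟨⟨x, hx⟩⟩
  rw [← dist_toSimpleGraph C ⟨x, hx⟩ ⟨y, hy⟩]
  exact SimpleGraph.dist_le_diam
    (SimpleGraph.connected_iff_ediam_ne_top.1 C.connected_toSimpleGraph)

end Components

end PCG

theorem mainTheorem11 {V : Type*} [Fintype V] [DecidableEq V] (α β : ℝ) (hα : 0 < α) (hβ : 1 < β)
    (s : PCG.State V) (hNash : PCG.IsNash α β s) (hdisc : PCG.IsDisconnected s)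
    (hne : s ≠ PCG.emptyState V) :
    α < 12 * (PCG.minSize s : ℝ) * Real.log (PCG.minSize s) ∧
    β ≤ 1 + 2 * (PCG.minDiam s : ℝ) ∧
    β < 1 + 14 * √((PCG.minSize s : ℝ) * Real.log (PCG.minSize s)) ∧
    (6 < Fintype.card V → β < (Fintype.card V : ℝ) / 2) := by
  obtain ⟨⟨C, hC, hCsize⟩, -⟩ := PCG.isLeast_minSize hne
  obtain ⟨⟨D, hD, hDdiam⟩, hmin⟩ := PCG.isLeast_minDiam hne
  obtain ⟨u, v, huv, huC⟩ := PCG.exists_mem_strategy_of_nontrivial hC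
  obtain ⟨u', v', huv', huD⟩ := PCG.exists_mem_strategy_of_nontrivial hD
  obtain ⟨w, hw⟩ := hdisc.exists_not_reachable u
  obtain ⟨w', hw'⟩ := hdisc.exists_not_reachable u'
  have h1 : α < 12 * (PCG.minSize s : ℝ) * Real.log (PCG.minSize s) := by
    rw [hCsize, PCG.ncard_supp_eq_card_comp huC]
    exact hNash.cost_lt hα (PCG.adj_of_mem_strategy huv) hw
  have h2 : β ≤ 1 + 2 * (PCG.minDiam s : ℝ) := by
    rw [hDdiam]
    refine hNash.penalty_le hα huv' hw' fun x y hx hxy => ?_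
    have hxD := PCG.mem_supp_of_reachable huD hx
    exact PCG.dist_le_diam_toSimpleGraph hxD (PCG.mem_supp_of_reachable hxD hxy)
  refine ⟨h1, h2, ?_, hNash.penalty_lt hα huv hw⟩
  -- The two minima may belong to different components, but `minDiam` is at most the diameter of the
  -- smallest component `C`, where a diametral pair is tested.
  have h3 : (PCG.minDiam s : ℝ) ^ 2 ≤ 4 * α + 1 := by
    have : Nonempty C := ⟨⟨u, huC⟩⟩
    obtain ⟨x, y, hxy⟩ := C.toSimpleGraph.exists_dist_eq_diam
    have h4 : PCG.minDiam s ≤ (PCG.graph s).dist x y := by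
      rw [← PCG.dist_toSimpleGraph, hxy]
      exact hmin ⟨C, hC, rfl⟩
    have h5 := hNash.dist_sq_le hα (C.reachable_of_mem_supp x.2 y.2)
    have h6 : (PCG.minDiam s : ℝ) ≤ (PCG.graph s).dist x y := by exact_mod_cast h4
    refine le_trans ?_ h5
    gcongr
  have hn : (2 : ℝ) ≤ PCG.minSize s := by
    rw [hCsize]
    exact_mod_cast (Set.one_lt_ncard_iff_nontrivial).2 hC
  have hlog2 := Real.log_two_gt_d9
  have hlogn : Real.log 2 ≤ Real.log (PCG.minSize s) := Real.log_le_log (by norm_num) hn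
  have hX : 1 < (PCG.minSize s : ℝ) * Real.log (PCG.minSize s) := by nlinarith
  -- With `X = n_l log n_l > 1`, one has `4α + 1 < 48 X + 1 < 49 X`.
  have h4 : (PCG.minDiam s : ℝ) < 7 * √((PCG.minSize s : ℝ) * Real.log (PCG.minSize s)) := by
    apply lt_of_pow_lt_pow_left₀ 2 (by positivity)
    rw [mul_pow, Real.sq_sqrt (by linarith)]
    linarith
  linarith
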